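/- **Proposition 2.1.** Fix $T>0$. Let $\{u^\epsilon\}_{\epsilon>0}\subset C([0,T];L^2(\mathbb R^2;\mathbb R^2))$ be an approximate solution sequence of the two-dimensional incompressible Euler equations on $[0,T]$ with initial data $u_0\in L^2(\mathbb R^2;\mathbb R^2)$, $\omega_0=\operatorname{curl}(u_0)\in\mathcal M$. Here $\mathcal M$ is the space of finite signed Radon measures on $\mathbb R^2$ with the total variation norm and $\operatorname{curl}(u)=\partial_1u_2-\partial_2u_1$ in the sense of distributions. This means that $\omega^\epsilon(t)=\operatorname{curl}(u^\epsilon(t))\in\mathcal M$ for all $\epsilon>0$, $t\in[0,T]$, and that 1. there is $C$ with $\sup_{t\in[0,T]}\|u^\epsilon(t)\|_{L^2}\le C$ for all $\epsilon>0$; 2. there is $C$ with $\sup_{t\in[0,T]}\|\omega^\epsilon(t)\|_{\mathcal M}\le C$ for all $\epsilon>0$; 3. there are $L>0$ and $M$ such that $\|u^\epsilon(t)-u^\epsilon(s)\|_{H^{-L}}\le M|t-s|$ for all $\epsilon>0$ and $s,t\in[0,T]$, where $\|f\|_{H^{-L}}^2=\int_{\mathbb R^2}(1+|\xi|^2)^{-L}|\hat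 f(\xi)|^2\,d\xi$; and $$\lim_{\epsilon\to0}\int_0^T\int_{\mathbb R^2}(\partial_t\varphi)\cdot u^\epsilon+\nabla\varphi:(u^\epsilon\otimes u^\epsilon)\,dx\,dt=0$$ for all $\varphi\in C_c^\infty(\mathbb R^2\times(0,T);\mathbb R^2)$ with $\operatorname{div}_x\varphi=0$; 4. as $\epsilon\to0$, $u^\epsilon(0)\to u_0$ strongly in $L^2$, and $\int\psi\,d\omega^\epsilon(0)\to\int\psi\,d\omega_0$ for all $\psi\in C_0(\mathbb R^2)$ (the continuous functions vanishing at infinity). For $u\in L^2(\mathbb R^2;\mathbb R^2)$ and $r>0$ let $B_r(0)$ be the ball of radius $r$ about the origin and $$S_2(u;r)=\Big(\frac1{|B_r(0)|}\int_{B_r(0)}\int_{\mathbb R^2}|u(x+h)-u(x)|^2\,dx\,dh\Big)^{1/2}.$$ Suppose there is a function $\phi$, independent of $\epsilon$, with $\phi(r)\to0$ as $r\to0^+$ (a uniform modulus of continuity), such that $$\sup_{t\in[0,T]}S_2(u^\epsilon(t);r)\le\phi(r)\qquad\text{for all } r>0 \text{ and all } \epsilon>0.$$ Then $\{u^\epsilon\}_{\epsilon>0}$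 is strongly precompact in $L^2([0,T];L^2_{\mathrm{loc}}(\mathbb R^2;\mathbb R^2))$: every sequence $(\epsilon_n)$ of positive numbers has a subsequence $(\epsilon_{n_k})$ for which there is a measurable $v:[0,T]\times\mathbb R^2\to\mathbb R^2$ with $\int_0^T\int_K|v|^2\,dx\,dt<\infty$ and $\int_0^T\int_K|u^{\epsilon_{n_k}}-v|^2\,dx\,dt\to0$ as $k\to\infty$, for every compact $K\subset\mathbb R^2$. -/

import Mathlib

open MeasureTheory Filter Topology Set
open scoped ENNReal

noncomputable section

namespace Euler2D

/-- The Euclidean plane. -/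
abbrev Plane : Type := EuclideanSpace ℝ (Fin 2)

/-- The Hilbert space of square integrable planar vector fields (modulo a.e. equality). -/
abbrev L2Field : Type := Lp Plane 2 (volume : Measure Plane)

/-- The `i`-th coordinate vector of the plane. -/
def basisVec (i : Fin 2) : Plane := EuclideanSpace.single i (1 : ℝ)

/-- `S₂(u; r) = ( ⨍_{B_r(0)} ∫ |u(x+h) - u(x)|² dx dh )^{1/2}`. Both integrands are integrable
for every square integrable `u`. -/
def structureFunction (u : L2Field) (r : ℝ) : ℝ :=
  Real.sqrt (⨍ h in Metric.ball (0 : Plane) r, ∫ x : Plane, ‖u (x + h) - u x‖ ^ 2)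

/-- The `i`-th component of a square integrable vector field, as a complex-valued `L²` function. -/
def component (u : L2Field) (i : Fin 2) : Lp ℂ 2 (volume : Measure Plane) :=
  (Complex.ofRealCLM.comp (EuclideanSpace.proj i : Plane →L[ℝ] ℝ)).compLp u

/-- The norm of the negative Sobolev space `H^{-L}`, evaluated at a square integrable vector field:
`( ∑ᵢ ∫ (1 + |ξ|²)^{-L} |ûᵢ(ξ)|² dξ )^{1/2}`. Here `ûᵢ` is the `L²` Fourier transform. -/
def negSobolevNorm (L : ℝ) (u : L2Field) : ℝ :=
  Real.sqrt (∑ i : Fin 2, ∫ ξ : Plane, (1 + ‖ξ‖ ^ 2) ^ (-L) *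
    ‖(FourierTransform.fourier (component u i) : Lp ℂ 2 (volume : Measure Plane)) ξ‖ ^ 2)

/-- `curl u = ∂₁u₂ - ∂₂u₁ = ω` in the sense of distributions, where `ω` is a finite signed Borel
measure: `∫ ψ dω = ∫ (u₁ ∂₂ψ - u₂ ∂₁ψ) dx` for every test function `ψ`. -/
def IsCurl (u : L2Field) (ω : SignedMeasure Plane) : Prop :=
  ∀ ψ : Plane → ℝ, ContDiff ℝ (⊤ : ℕ∞) ψ → HasCompactSupport ψ →
    ∫ᵛ x, ψ x ∂•ω =
      ∫ x : Plane, (u x 0 * fderiv ℝ ψ x (basisVec 1) - u x 1 * fderiv ℝ ψ x (basisVec 0))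

/-- `φ(t, x)` is a smooth vector field, compactly supported in `(0,T) × ℝ²`, whose spatial
divergence vanishes. -/
structure IsSolenoidalTestField (T : ℝ) (φ : ℝ × Plane → Plane) : Prop where
  contDiff : ContDiff ℝ (⊤ : ℕ∞) φ
  hasCompactSupport : HasCompactSupport φ
  tsupport_subset : tsupport φ ⊆ Ioo 0 T ×ˢ univ
  div_eq_zero : ∀ (t : ℝ) (x : Plane), ∑ i : Fin 2, fderiv ℝ φ (t, x) (0, basisVec i) i = 0

/-- `∫₀ᵀ ∫ ∂ₜφ · u + ∇φ : (u ⊗ u) dx dt`. -/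
def eulerWeakForm (T : ℝ) (u : ℝ → L2Field) (φ : ℝ × Plane → Plane) : ℝ :=
  ∫ t in (0 : ℝ)..T, ∫ x : Plane,
    (inner ℝ (fderiv ℝ φ (t, x) (1, 0)) (u t x) +
      ∑ i : Fin 2, ∑ j : Fin 2, fderiv ℝ φ (t, x) (0, basisVec j) i * (u t x i * u t x j))

/-- `u ε t` (`ε > 0`, `t ∈ [0,T]`), with vorticity `ω ε t`, is an approximate solution sequence of
the two-dimensional incompressible Euler equations with initial data `u₀`, `ω₀ = curl u₀`. -/
structure IsApproximateSolutionSequence (T : ℝ) (u : ℝ → ℝ → L2Field)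
    (ω : ℝ → ℝ → SignedMeasure Plane) (u₀ : L2Field) (ω₀ : SignedMeasure Plane) : Prop where
  continuousOn : ∀ ε > 0, ContinuousOn (u ε) (Icc 0 T)
  curl_eq : ∀ ε > 0, ∀ t ∈ Icc 0 T, IsCurl (u ε t) (ω ε t)
  curl_initial_eq : IsCurl u₀ ω₀
  energy_bound : ∃ C : ℝ, ∀ ε > 0, ∀ t ∈ Icc 0 T, ‖u ε t‖ ≤ C
  vorticity_bound : ∃ C : ℝ, ∀ ε > 0, ∀ t ∈ Icc 0 T,
    (ω ε t).totalVariation univ ≤ ENNReal.ofReal C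
  lipschitz : ∃ L > (0 : ℝ), ∃ M : ℝ, ∀ ε > 0, ∀ s ∈ Icc 0 T, ∀ t ∈ Icc 0 T,
    negSobolevNorm L (u ε t - u ε s) ≤ M * |t - s|
  weak_consistency : ∀ φ : ℝ × Plane → Plane, IsSolenoidalTestField T φ →
    Tendsto (fun ε => eulerWeakForm T (u ε) φ) (𝓝[>] 0) (𝓝 0)
  initial_velocity : Tendsto (fun ε => u ε 0) (𝓝[>] 0) (𝓝 u₀)
  initial_vorticity : ∀ ψ : ZeroAtInftyContinuousMap Plane ℝ,
    Tendsto (fun ε => ∫ᵛ x, ψ x ∂•(ω ε 0)) (𝓝[>] 0) (𝓝 (∫ᵛ x, ψ x ∂•ω₀))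

/-- `v(t, x)` belongs to `L²([0,T]; L²_loc(ℝ²))`: it is (a.e.) measurable on `[0,T] × ℝ²` and
`∫₀ᵀ ∫_K |v|² dx dt < ∞` for all compact `K`. -/
structure MemL2L2loc (T : ℝ) (v : ℝ → Plane → Plane) : Prop where
  aestronglyMeasurable : AEStronglyMeasurable (Function.uncurry v)
    ((volume.restrict (Icc 0 T)).prod (volume : Measure Plane))
  lintegral_lt_top : ∀ K : Set Plane, IsCompact K →
    ∫⁻ t in Icc 0 T, ∫⁻ x in K, ‖v t x‖ₑ ^ 2 < ∞

/-- Convergence in the Fréchet space `L²([0,T]; L²_loc(ℝ²))`: `∫₀ᵀ ∫_K |wₙ - v|² dx dt → 0` for all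
compact `K`. -/
def TendstoL2L2loc (T : ℝ) (w : ℕ → ℝ → Plane → Plane) (v : ℝ → Plane → Plane) : Prop :=
  ∀ K : Set Plane, IsCompact K →
    Tendsto (fun n => ∫⁻ t in Icc 0 T, ∫⁻ x in K, ‖w n t x - v t x‖ₑ ^ 2) atTop (𝓝 0)

/-- The family `{u ε}_{ε > 0}` is strongly precompact in `L²([0,T]; L²_loc(ℝ²))`: every sequence in
the family has a subsequence converging strongly to an element of that (metrizable) space. -/
def IsPrecompactL2L2loc (T : ℝ) (u : ℝ → ℝ → L2Field) : Prop :=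
  ∀ e : ℕ → ℝ, (∀ n, 0 < e n) →
    ∃ k : ℕ → ℕ, StrictMono k ∧ ∃ v : ℝ → Plane → Plane, MemL2L2loc T v ∧
      TendstoL2L2loc T (fun n t x => u (e (k n)) t x) v

end Euler2D

end

/-! Compactness comes separately in time and in space. The energy bound and the Lipschitz bound in
`H^{-L}` make the curves equicontinuous for the weak topology of `L²`
(`exists_abs_inner_le_of_negSobolevNorm`), so an Arzelà–Ascoli argument gives one subsequence
converging weakly at every time (`exists_subseq_weak_limit`).

At a fixed time, averaging over balls of radius `r` turns weak convergence into strong convergence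
on compact sets: averages are inner products with fixed kernels and are uniformly bounded. By
Jensen's inequality a field differs from its averages in `L²` by at most `S₂(u; r)`, which is at
most `φ r` uniformly along the sequence. Hence the fields themselves converge strongly on compact
sets (`tendsto_restrict_of_structureFunction`), and dominated convergence in time concludes. The
limit, given as an `L²` class for each time, gets a jointly measurable representative from Lebesgue
differentiation. -/

noncomputable section

namespace Euler2D

/-! ### Weak compactness of curves in a Hilbert space. -/

section WeakCompactness

/-- A sequence that is uniformly approximated by Cauchy sequences is Cauchy. -/
theorem cauchySeq_of_forall_approx {X : Type*} [PseudoMetricSpace X] {a : ℕ → X}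
    (h : ∀ κ > 0, ∃ b : ℕ → X, CauchySeq b ∧ ∀ n, dist (a n) (b n) ≤ κ) : CauchySeq a := by
  rw [Metric.cauchySeq_iff]
  intro κ hκ
  obtain ⟨b, hb, hab⟩ := h (κ / 4) (by positivity)
  obtain ⟨N, hN⟩ := Metric.cauchySeq_iff.1 hb (κ / 4) (by positivity)
  refine ⟨N, fun m hm n hn => ?_⟩
  have h1 := dist_triangle4 (a m) (b m) (b n) (a n)
  have h2 := hN m hm n hn
  have h3 := hab m
  have h4 := hab n
  rw [dist_comm] at h4
  linarith

variable {H : Type*} [NormedAddCommGroup H] [InnerProductSpace ℝ H] [CompleteSpace H]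

/-- The pointwise limit of the functionals is bounded by Banach–Steinhaus, and Riesz representation
turns it into a vector. -/
theorem exists_weak_limit {w : ℕ → H}
    (h : ∀ g : H, CauchySeq fun n => inner ℝ g (w n)) :
    ∃ V : H, ∀ g : H, Tendsto (fun n => inner ℝ g (w n)) atTop (𝓝 (inner ℝ g V)) := by
  choose f hf using fun g => cauchySeq_tendsto_of_complete (h g)
  have hlim : Tendsto (fun n g => innerSL ℝ (w n) g) atTop (𝓝 f) := by
    rw [tendsto_pi_nhds]
    intro g
    simpa [real_inner_comm] using hf g
  refine ⟨(InnerProductSpace.toDual ℝ H).symm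
    (continuousLinearMapOfTendsto (fun n => innerSL ℝ (w n)) hlim), fun g => ?_⟩
  rw [real_inner_comm, InnerProductSpace.toDual_symm_apply]
  exact hf g

/-- Arzelà–Ascoli for the weak topology: a bounded, weakly equicontinuous sequence of curves in a
separable Hilbert space has a subsequence converging weakly at all times. -/
theorem exists_subseq_weak_limit [SecondCountableTopology H] {C : ℝ} {w : ℕ → ℝ → H}
    (hC : ∀ n t, ‖w n t‖ ≤ C)
    (hw : ∀ g : H, ∀ κ > 0, ∃ ρ > 0, ∀ n s t, |t - s| < ρ → |inner ℝ g (w n t - w n s)| ≤ κ) :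
    ∃ k : ℕ → ℕ, StrictMono k ∧ ∃ V : ℝ → H, ∀ t g,
      Tendsto (fun n => inner ℝ g (w (k n) t)) atTop (𝓝 (inner ℝ g (V t))) := by
  have hC0 : 0 ≤ C := (norm_nonneg _).trans (hC 0 0)
  set q := TopologicalSpace.denseSeq ℝ
  set G := TopologicalSpace.denseSeq H
  -- Tychonoff on a countable product replaces the diagonal extraction over dense times and dense
  -- test vectors.
  have hcpt : IsCompact (Set.pi univ fun p : ℕ × ℕ => Icc (-(‖G p.2‖ * C)) (‖G p.2‖ * C)) :=
    isCompact_univ_pi fun _ => isCompact_Icc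
  obtain ⟨a, -, k, hk, ha⟩ := hcpt.tendsto_subseq
    (x := fun n p => inner ℝ (G p.2) (w n (q p.1))) (by
      intro n p _
      refine abs_le.1 ?_
      exact (abs_real_inner_le_norm _ _).trans (by gcongr; exact hC _ _))
  rw [tendsto_pi_nhds] at ha
  refine ⟨k, hk, ?_⟩
  have hcau : ∀ t g, CauchySeq fun n => inner ℝ g (w (k n) t) := by
    intro t g
    apply cauchySeq_of_forall_approx
    intro κ hκ
    obtain ⟨j, hj⟩ : ∃ j, dist g (G j) < κ / 2 / (C + 1) :=
      (TopologicalSpace.denseRange_denseSeq H).exists_dist_lt g (by positivity)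
    obtain ⟨ρ, hρ, hequi⟩ := hw (G j) (κ / 2) (by positivity)
    obtain ⟨i, hi⟩ : ∃ i, dist t (q i) < ρ :=
      (TopologicalSpace.denseRange_denseSeq ℝ).exists_dist_lt t hρ
    refine ⟨_, (ha (i, j)).cauchySeq, fun n => ?_⟩
    have h1 := hequi (k n) (q i) t hi
    have h2 : |inner ℝ (g - G j) (w (k n) t)| ≤ κ / 2 := by
      refine (abs_real_inner_le_norm _ _).trans ?_
      rw [← dist_eq_norm]
      calc dist g (G j) * ‖w (k n) t‖ ≤ κ / 2 / (C + 1) * (C + 1) := by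
            gcongr
            exact (hC _ _).trans (by linarith)
        _ = κ / 2 := by field_simp
    rw [Real.dist_eq]
    have h3 : inner ℝ g (w (k n) t) - inner ℝ (G j) (w (k n) (q i)) =
        inner ℝ (g - G j) (w (k n) t) + inner ℝ (G j) (w (k n) t - w (k n) (q i)) := by
      rw [inner_sub_left, inner_sub_right]; ring
    simp only [Function.comp]
    rw [h3]
    exact (abs_add_le _ _).trans (by linarith)
  choose V hV using fun t => exists_weak_limit (hcau t)
  exact ⟨V, hV⟩

/-- If the images of a weakly convergent sequence under a bounded operator form a Cauchy sequence,
they converge to the image of the weak limit. -/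
theorem tendsto_map_of_weak_limit {F : Type*} [NormedAddCommGroup F] [InnerProductSpace ℝ F]
    [CompleteSpace F] (P : H →L[ℝ] F) {w : ℕ → H} {V : H}
    (hw : ∀ g : H, Tendsto (fun n => inner ℝ g (w n)) atTop (𝓝 (inner ℝ g V)))
    (hP : CauchySeq fun n => P (w n)) : Tendsto (fun n => P (w n)) atTop (𝓝 (P V)) := by
  obtain ⟨y, hy⟩ := cauchySeq_tendsto_of_complete hP
  suffices y = P V from this ▸ hy
  refine ext_inner_left ℝ fun g => ?_
  refine tendsto_nhds_unique (tendsto_const_nhds.inner hy) ?_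
  simpa only [ContinuousLinearMap.adjoint_inner_left] using hw (P.adjoint g)

-- Test the weak convergence against the limit itself.
omit [CompleteSpace H] in
theorem norm_le_of_weak_limit {C : ℝ} {w : ℕ → H} {V : H}
    (hw : ∀ g : H, Tendsto (fun n => inner ℝ g (w n)) atTop (𝓝 (inner ℝ g V)))
    (hC : ∀ n, ‖w n‖ ≤ C) : ‖V‖ ≤ C := by
  have h : inner ℝ V V ≤ ‖V‖ * C := le_of_tendsto (hw V) (Eventually.of_forall fun n =>
    (real_inner_le_norm _ _).trans (by gcongr; exact hC n))
  rw [real_inner_self_eq_norm_mul_norm] at h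
  rcases (norm_nonneg V).eq_or_lt with h0 | h0
  · rw [← h0]; exact (norm_nonneg _).trans (hC 0)
  · exact le_of_mul_le_mul_left h h0

end WeakCompactness

/-! ### From negative Sobolev norms to weak equicontinuity. -/

section NegativeSobolev

variable {α E : Type*} [MeasurableSpace α] {μ : Measure α} [NormedAddCommGroup E]

theorem integrable_norm_sq (f : Lp E 2 μ) : Integrable (fun x => ‖f x‖ ^ 2) μ :=
  (Lp.memLp f).integrable_norm_pow (p := 2) two_ne_zero

theorem integral_norm_sq {𝕜 : Type*} [RCLike 𝕜] [InnerProductSpace 𝕜 E] (f : Lp E 2 μ) :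
    ∫ x, ‖f x‖ ^ 2 ∂μ = ‖f‖ ^ 2 := by
  have h := L2.inner_def (𝕜 := 𝕜) f f
  simp only [inner_self_eq_norm_sq_to_K] at h
  have h2 : (((∫ x, ‖f x‖ ^ 2 ∂μ : ℝ)) : 𝕜) = ((‖f‖ ^ 2 : ℝ) : 𝕜) := by
    rw [← integral_ofReal]
    push_cast
    exact h.symm
  exact_mod_cast h2

/-- On bounded sets of `L²`, smallness of a weighted norm with positive weight `m ≤ 1` forces
smallness of inner products with a fixed function. -/
theorem exists_norm_inner_le_of_weight {m : α → ℝ} (hm : Measurable m) (hm0 : ∀ x, 0 < m x)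
    (hm1 : ∀ x, m x ≤ 1) (g : Lp ℂ 2 μ) (C : ℝ) {κ : ℝ} (hκ : 0 < κ) :
    ∃ ρ > 0, ∀ f : Lp ℂ 2 μ, ‖f‖ ≤ C → ∫ x, m x * ‖f x‖ ^ 2 ∂μ ≤ ρ → ‖inner ℂ g f‖ ≤ κ := by
  -- Chosen so that `η * (1 + C ^ 2) = κ`; each of the two terms in the final estimate is then at
  -- most `κ / 2`.
  set η : ℝ := κ / (C ^ 2 + 1)
  have hη : 0 < η := by positivity
  have hmeas : ∀ δ : ℝ, AEStronglyMeasurable (fun x => δ / (m x + δ) * ‖g x‖ ^ 2) μ := fun δ =>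
    ((measurable_const.div (hm.add measurable_const)).aestronglyMeasurable).mul
      (integrable_norm_sq g).aestronglyMeasurable
  have hle : ∀ δ > 0, ∀ x, ‖δ / (m x + δ) * ‖g x‖ ^ 2‖ ≤ ‖g x‖ ^ 2 := by
    intro δ hδ x
    have h0 := hm0 x
    rw [Real.norm_of_nonneg (by positivity)]
    refine mul_le_of_le_one_left (by positivity) ?_
    rw [div_le_one (by positivity)]
    linarith
  have hlim : Tendsto (fun δ : ℝ => ∫ x, δ / (m x + δ) * ‖g x‖ ^ 2 ∂μ) (𝓝[>] 0) (𝓝 0) := by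
    suffices Tendsto (fun δ : ℝ => ∫ x, δ / (m x + δ) * ‖g x‖ ^ 2 ∂μ) (𝓝[>] 0)
        (𝓝 (∫ x, (0 : ℝ) ∂μ)) by simpa using this
    refine tendsto_integral_filter_of_dominated_convergence (fun x => ‖g x‖ ^ 2)
      (Eventually.of_forall hmeas) ?_ (integrable_norm_sq g) (ae_of_all _ fun x => ?_)
    · filter_upwards [self_mem_nhdsWithin] with δ hδ
      exact ae_of_all _ (hle δ hδ)
    · have h : Tendsto (fun δ : ℝ => δ / (m x + δ) * ‖g x‖ ^ 2) (𝓝 0)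
          (𝓝 (0 / (m x + 0) * ‖g x‖ ^ 2)) :=
        (tendsto_id.div (tendsto_const_nhds.add tendsto_id) (by simpa using (hm0 x).ne')).mul_const _
      simp only [zero_div, zero_mul] at h
      exact h.mono_left nhdsWithin_le_nhds
  have hev := (hlim.eventually (gt_mem_nhds (show (0 : ℝ) < η * κ by positivity))).and
    self_mem_nhdsWithin
  obtain ⟨δ, hδ1, hδ⟩ := hev.exists
  replace hδ : 0 < δ := hδ
  refine ⟨δ, hδ, fun f hf hfm => ?_⟩
  have hmf : Integrable (fun x => m x * ‖f x‖ ^ 2) μ := by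
    refine (integrable_norm_sq f).mono (hm.aestronglyMeasurable.mul
      (integrable_norm_sq f).aestronglyMeasurable) (ae_of_all _ fun x => ?_)
    have h0 := hm0 x
    rw [Real.norm_of_nonneg (by positivity), Real.norm_of_nonneg (by positivity)]
    exact mul_le_of_le_one_left (by positivity) (hm1 x)
  have hgδ : Integrable (fun x => δ / (m x + δ) * ‖g x‖ ^ 2) μ :=
    (integrable_norm_sq g).mono' (hmeas δ) (ae_of_all _ (hle δ hδ))
  -- Young's inequality with the weight `(m + δ) / δ` on `f` and its inverse on `g`: the difference
  -- of the two sides is a square.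
  have hpt : ∀ x, ‖inner ℂ (g x) (f x)‖ ≤
      η / 2 * (δ⁻¹ * (m x * ‖f x‖ ^ 2) + ‖f x‖ ^ 2) +
        (2 * η)⁻¹ * (δ / (m x + δ) * ‖g x‖ ^ 2) := by
    intro x
    have h0 := hm0 x
    refine (norm_inner_le_norm _ _).trans ?_
    have h1 : η / 2 * (δ⁻¹ * (m x * ‖f x‖ ^ 2) + ‖f x‖ ^ 2) +
        (2 * η)⁻¹ * (δ / (m x + δ) * ‖g x‖ ^ 2) - ‖g x‖ * ‖f x‖ =
        (η * (m x + δ) * ‖f x‖ - δ * ‖g x‖) ^ 2 / (2 * η * δ * (m x + δ)) := by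
      field_simp
      ring
    have h2 : 0 ≤ (η * (m x + δ) * ‖f x‖ - δ * ‖g x‖) ^ 2 / (2 * η * δ * (m x + δ)) := by
      positivity
    linarith
  have hint : Integrable (fun x => η / 2 * (δ⁻¹ * (m x * ‖f x‖ ^ 2) + ‖f x‖ ^ 2)) μ :=
    ((hmf.const_mul _).add (integrable_norm_sq f)).const_mul _
  rw [L2.inner_def]
  calc ‖∫ x, inner ℂ (g x) (f x) ∂μ‖
      ≤ ∫ x, (η / 2 * (δ⁻¹ * (m x * ‖f x‖ ^ 2) + ‖f x‖ ^ 2) +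
        (2 * η)⁻¹ * (δ / (m x + δ) * ‖g x‖ ^ 2)) ∂μ :=
        norm_integral_le_of_norm_le (hint.add (hgδ.const_mul _)) (ae_of_all _ hpt)
    _ = η / 2 * (δ⁻¹ * (∫ x, m x * ‖f x‖ ^ 2 ∂μ) + ‖f‖ ^ 2) +
        (2 * η)⁻¹ * ∫ x, δ / (m x + δ) * ‖g x‖ ^ 2 ∂μ := by
        rw [integral_add hint (hgδ.const_mul _), integral_const_mul, integral_const_mul,
          integral_add (hmf.const_mul _) (integrable_norm_sq f), integral_const_mul,
          integral_norm_sq (𝕜 := ℂ)]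
    _ ≤ η / 2 * (δ⁻¹ * δ + C ^ 2) + (2 * η)⁻¹ * (η * κ) := by gcongr
    _ = κ := by
        rw [inv_mul_cancel₀ hδ.ne']
        have : η * (1 + C ^ 2) = κ := by simp only [η]; field_simp; ring
        field_simp
        linarith

theorem component_coeFn (u : L2Field) (i : Fin 2) :
    ∀ᵐ x, component u i x = ((u x i : ℝ) : ℂ) := by
  filter_upwards [ContinuousLinearMap.coeFn_compLp
    (Complex.ofRealCLM.comp (EuclideanSpace.proj i : Plane →L[ℝ] ℝ)) u] with x hx
  rw [component, hx]
  simp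

theorem norm_component_le (u : L2Field) (i : Fin 2) : ‖component u i‖ ≤ ‖u‖ := by
  refine Lp.norm_le_norm_of_ae_le ?_
  filter_upwards [component_coeFn u i] with x hx
  rw [hx, Complex.norm_real]
  exact PiLp.norm_apply_le _ _

theorem inner_eq_sum_component (g u : L2Field) :
    ((inner ℝ g u : ℝ) : ℂ) = ∑ i : Fin 2, inner ℂ (component g i) (component u i) := by
  simp_rw [L2.inner_def]
  rw [← integral_finsetSum _ fun i _ => L2.integrable_inner _ _, ← integral_complex_ofReal]
  refine integral_congr_ae ?_
  filter_upwards [component_coeFn g 0, component_coeFn g 1, component_coeFn u 0,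
    component_coeFn u 1] with x h1 h2 h3 h4
  simp [Fin.sum_univ_two, h1, h2, h3, h4, PiLp.inner_apply]

theorem weight_pos (L : ℝ) (ξ : Plane) : 0 < (1 + ‖ξ‖ ^ 2) ^ (-L) := by positivity

/-- On bounded sets of `L²`, smallness in `H^{-L}` forces smallness of inner products with a fixed
field. -/
theorem exists_abs_inner_le_of_negSobolevNorm {L : ℝ} (hL : 0 < L) (g : L2Field) (C : ℝ) {κ : ℝ}
    (hκ : 0 < κ) :
    ∃ ρ > 0, ∀ w : L2Field, ‖w‖ ≤ C → negSobolevNorm L w ≤ ρ → |inner ℝ g w| ≤ κ := by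
  have hm : Measurable fun ξ : Plane => (1 + ‖ξ‖ ^ 2) ^ (-L) := by fun_prop
  have hm1 : ∀ ξ : Plane, (1 + ‖ξ‖ ^ 2) ^ (-L) ≤ 1 := fun ξ =>
    Real.rpow_le_one_of_one_le_of_nonpos (by nlinarith [sq_nonneg ‖ξ‖]) (by linarith)
  choose ρ hρ h using fun i : Fin 2 => exists_norm_inner_le_of_weight hm (weight_pos L) hm1
    (FourierTransform.fourier (component g i) : Lp ℂ 2 (volume : Measure Plane)) C (half_pos hκ)
  refine ⟨√(min (ρ 0) (ρ 1)), Real.sqrt_pos.2 (lt_min (hρ 0) (hρ 1)), fun w hw hs => ?_⟩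
  have hnn : ∀ i, 0 ≤ ∫ ξ : Plane, (1 + ‖ξ‖ ^ 2) ^ (-L) *
      ‖(FourierTransform.fourier (component w i) : Lp ℂ 2 (volume : Measure Plane)) ξ‖ ^ 2 :=
    fun i => integral_nonneg fun ξ => mul_nonneg (weight_pos L ξ).le (sq_nonneg _)
  have hs' := (Real.sqrt_le_sqrt_iff (lt_min (hρ 0) (hρ 1)).le).1 hs
  have hi : ∀ i, ‖inner ℂ (component g i) (component w i)‖ ≤ κ / 2 := by
    intro i
    -- Plancherel moves the pairing to the frequency side, where the weight acts.
    rw [← Lp.inner_fourier_eq]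
    refine h i _ ?_ ?_
    · rw [Lp.norm_fourier_eq]
      exact (norm_component_le w i).trans hw
    · refine (Finset.single_le_sum (fun j _ => hnn j) (Finset.mem_univ i)).trans (hs'.trans ?_)
      fin_cases i
      · exact min_le_left _ _
      · exact min_le_right _ _
  rw [← Real.norm_eq_abs, ← Complex.norm_real, inner_eq_sum_component, Fin.sum_univ_two]
  exact (norm_add_le _ _).trans (by linarith [hi 0, hi 1])

end NegativeSobolev


/-! ### Ball averages and strong convergence on compact sets. -/

section BallAverage

theorem enorm_sq_eq_lintegral {α E : Type*} [MeasurableSpace α] {μ : Measure α}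
    [NormedAddCommGroup E] {f : Lp E 2 μ} {F : α → E} (h : f =ᵐ[μ] F) :
    ‖f‖ₑ ^ 2 = ∫⁻ x, ‖F x‖ₑ ^ 2 ∂μ := by
  have h2 := eLpNorm_nnreal_pow_eq_lintegral (μ := μ) (f := F) (p := 2) two_ne_zero
  rw [Lp.enorm_def, eLpNorm_congr_ae h]
  simpa using h2

/-- The average of `u` over the ball of radius `r` about `x`. -/
def ballAverage (r : ℝ) (u : L2Field) (x : Plane) : Plane :=
  ⨍ y in Metric.closedBall x r, u y

/-- Spheres are null. This reconciles the open balls of the structure function with the closed balls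
of Lebesgue differentiation. -/
theorem closedBall_ae_eq_ball (x : Plane) (r : ℝ) :
    (Metric.closedBall x r : Set Plane) =ᵐ[volume] Metric.ball x r := by
  rw [← Metric.ball_union_sphere]
  exact union_ae_eq_left_of_ae_eq_empty (ae_eq_empty.2 (Measure.addHaar_sphere _ _ _))

theorem integrableOn_closedBall (u : L2Field) (x : Plane) (r : ℝ) :
    IntegrableOn u (Metric.closedBall x r) volume :=
  integrableOn_Lp_of_measure_ne_top u fact_one_le_two_ennreal.elim measure_closedBall_lt_top.ne

theorem measurePreserving_add (x : Plane) :
    MeasurePreserving (fun h : Plane => x + h) volume volume :=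
  measurePreserving_add_left volume x

theorem memLp_add (u : L2Field) (x : Plane) : MemLp (fun h => u (x + h)) 2 volume :=
  (Lp.memLp u).comp_measurePreserving (measurePreserving_add x)

theorem ballAverage_eq_average_add (r : ℝ) (u : L2Field) (x : Plane) :
    ballAverage r u x = ⨍ h in Metric.ball (0 : Plane) r, u (x + h) := by
  have hpre : (fun h : Plane => x + h) ⁻¹' Metric.ball x r = Metric.ball 0 r := by
    ext h; simp
  rw [ballAverage, setAverage_eq, setAverage_eq, setIntegral_congr_set (closedBall_ae_eq_ball x r),
    ← (measurePreserving_add x).setIntegral_preimage_emb (measurableEmbedding_addLeft x) u, hpre,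
    measureReal_congr (closedBall_ae_eq_ball x r), Measure.addHaar_real_ball_center]

/-- Jensen's inequality for the convex function `‖·‖ ^ 2`. -/
theorem norm_sub_ballAverage_sq_le {r : ℝ} (hr : 0 < r) (u : L2Field) (x : Plane) :
    ‖u x - ballAverage r u x‖ ^ 2 ≤
      ⨍ h in Metric.ball (0 : Plane) r, ‖u (x + h) - u x‖ ^ 2 := by
  have : NeZero ((volume : Measure Plane).restrict (Metric.ball 0 r)) :=
    ⟨by simpa [Measure.restrict_eq_zero] using (Metric.measure_ball_pos volume (0 : Plane) hr).ne'⟩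
  have : IsFiniteMeasure ((volume : Measure Plane).restrict (Metric.ball 0 r)) :=
    isFiniteMeasure_restrict.2 measure_ball_lt_top.ne
  have hmem : MemLp (fun h => u (x + h) - u x) 2 (volume.restrict (Metric.ball (0 : Plane) r)) :=
    ((memLp_add u x).restrict _).sub (memLp_const _)
  have hu : Integrable (fun h => u (x + h)) (volume.restrict (Metric.ball (0 : Plane) r)) :=
    ((memLp_add u x).restrict _).integrable one_le_two
  have hconv : ConvexOn ℝ univ fun y : Plane => ‖y‖ ^ 2 :=
    (convexOn_norm convex_univ).pow (fun _ _ => norm_nonneg _) 2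
  have h := hconv.map_average_le (by fun_prop) isClosed_univ (ae_of_all _ fun _ => mem_univ _)
    (hmem.integrable one_le_two) (hmem.integrable_norm_pow (p := 2) two_ne_zero)
  refine le_trans (le_of_eq ?_) h
  rw [norm_sub_rev, ballAverage_eq_average_add]
  congr 2
  have : ⨍ _ in Metric.ball (0 : Plane) r, u x = u x := average_const _ _
  nth_rw 1 [← this]
  simp only [average_eq]
  rw [integral_sub hu (integrable_const _), smul_sub]

theorem stronglyMeasurable_translate_sub (u : L2Field) :
    StronglyMeasurable fun p : Plane × Plane => u (p.1 + p.2) - u p.1 :=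
  ((Lp.stronglyMeasurable u).comp_measurable (measurable_fst.add measurable_snd)).sub
    ((Lp.stronglyMeasurable u).comp_measurable measurable_fst)

theorem memLp_translate_sub (u : L2Field) (h : Plane) :
    MemLp (fun x => u (x + h) - u x) 2 volume := by
  have h1 := memLp_add u h
  simp only [add_comm h] at h1
  exact h1.sub (Lp.memLp u)

/-- The bound is uniform in `h`, so the outer integrand of the structure function is genuinely
integrable over the ball and its Bochner integral does not default to zero. -/
theorem integral_translate_sub_le (u : L2Field) (h : Plane) :
    ∫ x, ‖u (x + h) - u x‖ ^ 2 ≤ 4 * ‖u‖ ^ 2 := by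
  have h1 : Integrable (fun x => ‖u (x + h)‖ ^ 2) volume := (integrable_norm_sq u).comp_add_right h
  have h2 := integrable_norm_sq u
  calc ∫ x, ‖u (x + h) - u x‖ ^ 2 ≤ ∫ x, (2 * ‖u (x + h)‖ ^ 2 + 2 * ‖u x‖ ^ 2) := by
        refine integral_mono ((memLp_translate_sub u h).integrable_norm_pow (p := 2) two_ne_zero)
          ((h1.const_mul 2).add (h2.const_mul 2)) fun x => ?_
        have h3 := norm_sub_le (u (x + h)) (u x)
        have h4 := norm_nonneg (u (x + h) - u x)
        have h5 := pow_le_pow_left₀ h4 h3 2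
        dsimp only
        nlinarith [sq_nonneg (‖u (x + h)‖ - ‖u x‖)]
    _ = 4 * ‖u‖ ^ 2 := by
        rw [integral_add (h1.const_mul 2) (h2.const_mul 2), integral_const_mul, integral_const_mul,
          integral_add_right_eq_self (fun x => ‖u x‖ ^ 2) h, integral_norm_sq (𝕜 := ℝ)]
        ring

theorem ofReal_structureFunction_sq {r : ℝ} (hr : 0 < r) (u : L2Field) :
    ENNReal.ofReal (structureFunction u r ^ 2) = (volume (Metric.ball (0 : Plane) r))⁻¹ *
      ∫⁻ h in Metric.ball (0 : Plane) r, ∫⁻ x : Plane, ‖u (x + h) - u x‖ₑ ^ 2 := by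
  have hnn : ∀ h : Plane, 0 ≤ ∫ x : Plane, ‖u (x + h) - u x‖ ^ 2 :=
    fun h => integral_nonneg fun x => sq_nonneg _
  have hpos := Metric.measure_ball_pos volume (0 : Plane) hr
  have hmeas : StronglyMeasurable fun h : Plane => ∫ x : Plane, ‖u (x + h) - u x‖ ^ 2 :=
    ((stronglyMeasurable_translate_sub u).norm.pow 2).integral_prod_left'
  have hint : IntegrableOn (fun h : Plane => ∫ x : Plane, ‖u (x + h) - u x‖ ^ 2)
      (Metric.ball 0 r) volume := by
    refine Measure.integrableOn_of_bounded (M := 4 * ‖u‖ ^ 2) measure_ball_lt_top.ne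
      hmeas.aestronglyMeasurable (ae_of_all _ fun h => ?_)
    rw [Real.norm_of_nonneg (hnn h)]
    exact integral_translate_sub_le u h
  rw [structureFunction, setAverage_eq, smul_eq_mul, Real.sq_sqrt
    (mul_nonneg (by positivity) (integral_nonneg hnn)), ENNReal.ofReal_mul (by positivity),
    ofReal_integral_eq_lintegral_ofReal hint (ae_of_all _ hnn), measureReal_def,
    ENNReal.ofReal_inv_of_pos (ENNReal.toReal_pos hpos.ne' measure_ball_lt_top.ne),
    ENNReal.ofReal_toReal measure_ball_lt_top.ne]
  congr 1
  refine lintegral_congr fun h => ?_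
  rw [ofReal_integral_eq_lintegral_ofReal
    ((memLp_translate_sub u h).integrable_norm_pow (p := 2) two_ne_zero)
    (ae_of_all _ fun x => sq_nonneg _)]
  refine lintegral_congr fun x => ?_
  rw [ENNReal.ofReal_pow (norm_nonneg _), ofReal_norm]

/-- A field is close in `L²` to its ball averages, with distance at most its structure function. -/
theorem lintegral_sub_ballAverage_le {r : ℝ} (hr : 0 < r) (u : L2Field) :
    ∫⁻ x, ‖u x - ballAverage r u x‖ₑ ^ 2 ≤ ENNReal.ofReal (structureFunction u r ^ 2) := by
  have hpos := Metric.measure_ball_pos volume (0 : Plane) hr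
  have hm : Measurable fun p : Plane × Plane => ‖u (p.1 + p.2) - u p.1‖ₑ ^ 2 :=
    (stronglyMeasurable_translate_sub u).measurable.enorm.pow_const 2
  rw [ofReal_structureFunction_sq hr, lintegral_lintegral_swap
    (f := fun h x : Plane => ‖u (x + h) - u x‖ₑ ^ 2) (hm.comp measurable_swap).aemeasurable, ← lintegral_const_mul' _ _ (by simpa using hpos.ne')]
  refine lintegral_mono fun x => ?_
  have : IsFiniteMeasure ((volume : Measure Plane).restrict (Metric.ball 0 r)) :=
    isFiniteMeasure_restrict.2 measure_ball_lt_top.ne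
  have hmem : MemLp (fun h => u (x + h) - u x) 2 (volume.restrict (Metric.ball (0 : Plane) r)) :=
    ((memLp_add u x).restrict _).sub (memLp_const _)
  dsimp only
  rw [← ofReal_norm, ← ENNReal.ofReal_pow (norm_nonneg _)]
  refine (ENNReal.ofReal_le_ofReal (norm_sub_ballAverage_sq_le hr u x)).trans (le_of_eq ?_)
  rw [setAverage_eq, smul_eq_mul, ENNReal.ofReal_mul (by positivity),
    ofReal_integral_eq_lintegral_ofReal (hmem.integrable_norm_pow (p := 2) two_ne_zero)
      (ae_of_all _ fun _ => sq_nonneg _), measureReal_def,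
    ENNReal.ofReal_inv_of_pos (ENNReal.toReal_pos hpos.ne' measure_ball_lt_top.ne),
    ENNReal.ofReal_toReal measure_ball_lt_top.ne]
  congr 1
  refine lintegral_congr fun h => ?_
  rw [ENNReal.ofReal_pow (norm_nonneg _), ofReal_norm]

theorem continuous_ballAverage (r : ℝ) (u : L2Field) : Continuous (ballAverage r u) := by
  have h : Continuous fun x => ∫ y in Metric.closedBall x r, u y := by
    rw [continuous_iff_continuousAt]
    intro x₀
    simp_rw [← integral_indicator Metric.isClosed_closedBall.measurableSet]
    refine continuousAt_of_dominated
      (bound := (Metric.closedBall x₀ (r + 1)).indicator fun y => ‖u y‖)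
      (Eventually.of_forall fun x => (Lp.aestronglyMeasurable u).indicator
        Metric.isClosed_closedBall.measurableSet) ?_
      (IntegrableOn.integrable_indicator (integrableOn_closedBall u x₀ (r + 1)).norm
        Metric.isClosed_closedBall.measurableSet) ?_
    · filter_upwards [Metric.closedBall_mem_nhds x₀ one_pos] with x hx
      refine ae_of_all _ fun y => ?_
      rw [norm_indicator_eq_indicator_norm]
      refine indicator_le_indicator_of_subset ?_ (fun _ => norm_nonneg _) y
      exact Metric.closedBall_subset_closedBall' (by
        have h := Metric.mem_closedBall.1 hx
        linarith)
    -- Off this null sphere, the indicator at `y` is locally constant in the centre near `x₀`.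
    · have hs : ∀ᵐ y ∂(volume : Measure Plane), y ∉ Metric.sphere x₀ r :=
        measure_eq_zero_iff_ae_notMem.1 (Measure.addHaar_sphere _ _ _)
      filter_upwards [hs] with y hy
      have hd : Continuous fun x : Plane => dist y x := by fun_prop
      rcases lt_or_gt_of_ne (show dist y x₀ ≠ r from hy) with hlt | hgt
      · refine continuousAt_const.congr (f := fun _ => u y) ?_
        filter_upwards [hd.continuousAt.eventually (gt_mem_nhds hlt)] with x hx
        rw [indicator_of_mem (Metric.mem_closedBall.2 hx.le)]
      · refine continuousAt_const.congr (f := fun _ => 0) ?_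
        filter_upwards [hd.continuousAt.eventually (lt_mem_nhds hgt)] with x hx
        rw [indicator_of_notMem (by simpa using hx)]
  have h2 : ballAverage r u = fun x =>
      ((volume : Measure Plane).real (Metric.closedBall 0 r))⁻¹ •
        ∫ y in Metric.closedBall x r, u y := by
    ext1 x
    rw [ballAverage, setAverage_eq, Measure.addHaar_real_closedBall_center]
  rw [h2]
  exact Continuous.const_smul (M := ℝ) h _

/-- The square integrable field against which `u` is tested to give `⟪c, ballAverage r u x⟫`. -/
def averageKernel (r : ℝ) (x c : Plane) : L2Field :=
  ((volume : Measure Plane).real (Metric.closedBall 0 r))⁻¹ •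
    indicatorConstLp 2 (Metric.isClosed_closedBall (x := x) (ε := r)).measurableSet
      measure_closedBall_lt_top.ne c

/-- Through this identity, weak convergence yields pointwise convergence of averages, and
Cauchy–Schwarz yields their uniform bound. -/
theorem inner_averageKernel (r : ℝ) (x c : Plane) (u : L2Field) :
    inner ℝ (averageKernel r x c) u = inner ℝ c (ballAverage r u x) := by
  rw [averageKernel, inner_smul_left, L2.inner_indicatorConstLp_eq_inner_setIntegral, ballAverage,
    setAverage_eq, inner_smul_right, Measure.addHaar_real_closedBall_center volume x]
  rfl

theorem exists_norm_ballAverage_le (r : ℝ) :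
    ∃ D, 0 ≤ D ∧ ∀ (u : L2Field) (x : Plane), ‖ballAverage r u x‖ ≤ D * ‖u‖ := by
  set b := (volume : Measure Plane).real (Metric.closedBall 0 r)
  refine ⟨b⁻¹ * b ^ (1 / (2 : ℝ≥0∞).toReal), by positivity, fun u x => ?_⟩
  set c := ballAverage r u x
  have h := real_inner_le_norm (averageKernel r x c) u
  rw [inner_averageKernel, real_inner_self_eq_norm_mul_norm, averageKernel, norm_smul,
    norm_indicatorConstLp two_ne_zero ENNReal.ofNat_ne_top,
    Measure.addHaar_real_closedBall_center volume x, Real.norm_of_nonneg (by positivity)] at h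
  rcases (norm_nonneg c).eq_or_lt with h0 | h0
  · rw [← h0]; positivity
  · refine le_of_mul_le_mul_left (h.trans (le_of_eq ?_)) h0
    ring

theorem tendsto_plane_of_inner {ι : Type*} {l : Filter ι} {f : ι → Plane} {a : Plane}
    (h : ∀ c : Plane, Tendsto (fun n => inner ℝ c (f n)) l (𝓝 (inner ℝ c a))) :
    Tendsto f l (𝓝 a) := by
  have h2 : Tendsto (fun n => WithLp.ofLp (f n)) l (𝓝 (WithLp.ofLp a)) := by
    rw [tendsto_pi_nhds]
    intro i
    simpa [EuclideanSpace.inner_single_left] using h (EuclideanSpace.single i 1)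
  exact ((PiLp.continuous_toLp 2 _).tendsto _).comp h2

theorem tendsto_ballAverage {w : ℕ → L2Field} {V : L2Field}
    (hw : ∀ g : L2Field, Tendsto (fun n => inner ℝ g (w n)) atTop (𝓝 (inner ℝ g V)))
    (r : ℝ) (x : Plane) : Tendsto (fun n => ballAverage r (w n) x) atTop (𝓝 (ballAverage r V x)) :=
  tendsto_plane_of_inner fun c => by simpa only [inner_averageKernel] using hw (averageKernel r x c)

theorem memLp_ballAverage (r : ℝ) (u : L2Field) {K : Set Plane} (hK : IsCompact K) :
    MemLp (ballAverage r u) 2 (volume.restrict K) := by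
  have : IsFiniteMeasure ((volume : Measure Plane).restrict K) :=
    isFiniteMeasure_restrict.2 hK.measure_lt_top.ne
  obtain ⟨D, -, hD⟩ := exists_norm_ballAverage_le r
  exact MemLp.of_bound (continuous_ballAverage r u).aestronglyMeasurable (D * ‖u‖)
    (ae_of_all _ (hD u))

/-- Dominated convergence: averages converge pointwise and are bounded by a constant, which is
square integrable on `K`. -/
theorem tendsto_toLp_ballAverage {w : ℕ → L2Field} {V : L2Field} {C : ℝ} (hC : ∀ n, ‖w n‖ ≤ C)
    (hw : ∀ g : L2Field, Tendsto (fun n => inner ℝ g (w n)) atTop (𝓝 (inner ℝ g V)))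
    (r : ℝ) {K : Set Plane} (hK : IsCompact K) :
    Tendsto (fun n => (memLp_ballAverage r (w n) hK).toLp _) atTop
      (𝓝 ((memLp_ballAverage r V hK).toLp _)) := by
  obtain ⟨D, hD0, hD⟩ := exists_norm_ballAverage_le r
  have hVC := norm_le_of_weak_limit hw hC
  rw [tendsto_iff_edist_tendsto_0]
  have h2 : Tendsto (fun n => edist ((memLp_ballAverage r (w n) hK).toLp _)
      ((memLp_ballAverage r V hK).toLp _) ^ 2) atTop (𝓝 0) := by
    have heq : ∀ n, edist ((memLp_ballAverage r (w n) hK).toLp _)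
        ((memLp_ballAverage r V hK).toLp _) ^ 2 =
        ∫⁻ x in K, ‖ballAverage r (w n) x - ballAverage r V x‖ₑ ^ 2 := fun n => by
      rw [edist_eq_enorm_sub, ← MemLp.toLp_sub]
      exact enorm_sq_eq_lintegral (MemLp.coeFn_toLp _)
    simp_rw [heq]
    rw [← lintegral_zero (μ := (volume : Measure Plane).restrict K)]
    refine tendsto_lintegral_of_dominated_convergence'
      (fun _ => ENNReal.ofReal (D * C + D * C) ^ 2) (fun n => ?_) (fun n => ae_of_all _ fun x => ?_)
      ?_ (ae_of_all _ fun x => ?_)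
    · exact (((continuous_ballAverage r (w n)).sub
        (continuous_ballAverage r V)).measurable.enorm.pow_const 2).aemeasurable
    · dsimp only
      gcongr
      rw [← ofReal_norm]
      refine ENNReal.ofReal_le_ofReal ((norm_sub_le _ _).trans ?_)
      gcongr
      · exact (hD _ x).trans (by gcongr; exact hC n)
      · exact (hD _ x).trans (by gcongr)
    · rw [setLIntegral_const]
      exact (ENNReal.mul_lt_top (by simp) hK.measure_lt_top).ne
    · have h := ((tendsto_ballAverage hw r x).sub_const (ballAverage r V x)).enorm
      simpa using ENNReal.Tendsto.pow (n := 2) h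
  have h3 := h2.ennrpow_const (1 / 2 : ℝ)
  refine (h3.congr fun n => ?_).trans (by simp)
  rw [← ENNReal.rpow_natCast, ← ENNReal.rpow_mul]
  norm_num

/-- Restriction of square integrable fields to `K`. -/
abbrev restrictCLM (K : Set Plane) : L2Field →L[ℝ] Lp Plane 2 ((volume : Measure Plane).restrict K) :=
  LpToLpRestrictCLM Plane Plane ℝ volume 2 K

/-- Bounded weakly convergent fields with a uniform modulus of continuity for the structure
function converge strongly on compact sets. -/
theorem tendsto_restrict_of_structureFunction {w : ℕ → L2Field} {V : L2Field} {C : ℝ}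
    (hC : ∀ n, ‖w n‖ ≤ C)
    (hw : ∀ g : L2Field, Tendsto (fun n => inner ℝ g (w n)) atTop (𝓝 (inner ℝ g V)))
    {φ : ℝ → ℝ} (hφ : Tendsto φ (𝓝[>] 0) (𝓝 0))
    (hS : ∀ n, ∀ r > 0, structureFunction (w n) r ≤ φ r) {K : Set Plane} (hK : IsCompact K) :
    Tendsto (fun n => restrictCLM K (w n)) atTop (𝓝 (restrictCLM K V)) := by
  -- The weak limit identifies any strong limit, so only the Cauchy property is needed. Averages at
  -- a radius with `φ r < κ` are Cauchy and within `κ`, uniformly in `n`.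
  refine tendsto_map_of_weak_limit _ hw (cauchySeq_of_forall_approx fun κ hκ => ?_)
  obtain ⟨r, hrκ, hr⟩ := ((hφ.eventually (gt_mem_nhds hκ)).and self_mem_nhdsWithin).exists
  refine ⟨_, (tendsto_toLp_ballAverage hC hw r hK).cauchySeq, fun n => ?_⟩
  rw [dist_eq_norm]
  refine (pow_le_pow_iff_left₀ (norm_nonneg _) hκ.le two_ne_zero).1 ?_
  rw [← ENNReal.ofReal_le_ofReal_iff (by positivity), ENNReal.ofReal_pow (norm_nonneg _), ofReal_norm,
    enorm_sq_eq_lintegral (F := fun x => w n x - ballAverage r (w n) x)]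
  · refine (setLIntegral_le_lintegral _ _).trans ((lintegral_sub_ballAverage_le hr (w n)).trans ?_)
    refine ENNReal.ofReal_le_ofReal ?_
    gcongr
    · exact Real.sqrt_nonneg _
    · exact (hS n r hr).trans hrκ.le
  · exact (Lp.coeFn_sub _ _).trans
      ((LpToLpRestrictCLM_coeFn ℝ K (w n)).sub (MemLp.coeFn_toLp _))

end BallAverage


/-! ### A jointly measurable representative of the limit. -/

section JointMeasurability

/-- A representative of the curve `V`, obtained as the limit of its ball averages. -/
def jointRepresentative (V : ℝ → L2Field) (t : ℝ) (x : Plane) : Plane :=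
  limUnder atTop fun n : ℕ => ballAverage (1 / ((n : ℝ) + 1)) (V t) x

theorem jointRepresentative_ae_eq (V : ℝ → L2Field) (t : ℝ) :
    jointRepresentative V t =ᵐ[volume] V t := by
  have hloc : LocallyIntegrable (V t) volume :=
    (Lp.memLp (V t)).locallyIntegrable one_le_two
  filter_upwards [IsUnifLocDoublingMeasure.ae_tendsto_average volume hloc 1] with x hx
  refine Tendsto.limUnder_eq ?_
  refine hx (fun _ : ℕ => x) (fun n : ℕ => 1 / ((n : ℝ) + 1)) ?_ (Eventually.of_forall fun n => ?_)
  · exact tendsto_nhdsWithin_iff.2 ⟨tendsto_one_div_add_atTop_nhds_zero_nat,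
      Eventually.of_forall fun n => mem_Ioi.2 (by positivity)⟩
  · exact Metric.mem_closedBall_self (by positivity)

/-- Each average is a Carathéodory function: continuous in `x`, and measurable in `t` as a limit of
continuous functions. Joint measurability passes to the limit over radii. -/
theorem stronglyMeasurable_jointRepresentative {w : ℕ → ℝ → L2Field} {V : ℝ → L2Field}
    (hw : ∀ n, Continuous (w n))
    (hV : ∀ t g, Tendsto (fun n => inner ℝ g (w n t)) atTop (𝓝 (inner ℝ g (V t)))) :
    StronglyMeasurable (Function.uncurry (jointRepresentative V)) := by
  have hr : ∀ r : ℝ, StronglyMeasurable fun p : ℝ × Plane => ballAverage r (V p.1) p.2 := by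
    intro r
    have h : StronglyMeasurable (Function.uncurry fun (x : Plane) (t : ℝ) => ballAverage r (V t) x) :=
      stronglyMeasurable_uncurry_of_continuous_of_stronglyMeasurable
        (fun t => continuous_ballAverage r (V t)) fun x => by
          refine stronglyMeasurable_of_tendsto (f := fun n t => ballAverage r (w n t) x) atTop
            (fun n => ?_) (tendsto_pi_nhds.2 fun t => tendsto_ballAverage (hV t) r x)
          refine Continuous.stronglyMeasurable (continuous_iff_continuousAt.2 fun t => ?_)
          refine tendsto_plane_of_inner fun c => ?_
          simp only [← inner_averageKernel]
          exact tendsto_const_nhds.inner ((hw n).tendsto t)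
    have hswap : Measurable (Prod.swap : ℝ × Plane → Plane × ℝ) := measurable_swap
    have h2 := h.comp_measurable hswap
    exact h2
  change StronglyMeasurable fun p : ℝ × Plane =>
    limUnder atTop fun n : ℕ => ballAverage (1 / ((n : ℝ) + 1)) (V p.1) p.2
  exact StronglyMeasurable.limUnder fun n => hr _

end JointMeasurability

/-! ### Strong compactness of curves and the conclusion. -/

section Compactness

theorem lintegral_restrict_eq {V : ℝ → L2Field} (f : L2Field) (t : ℝ) (K : Set Plane) :
    ∫⁻ x in K, ‖f x - jointRepresentative V t x‖ₑ ^ 2 =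
      ‖restrictCLM K f - restrictCLM K (V t)‖ₑ ^ 2 := by
  refine (enorm_sq_eq_lintegral ((Lp.coeFn_sub _ _).trans ?_)).symm
  exact (LpToLpRestrictCLM_coeFn ℝ K f).sub ((LpToLpRestrictCLM_coeFn ℝ K (V t)).trans
    (ae_restrict_of_ae (jointRepresentative_ae_eq V t).symm))

theorem enorm_restrict_le {C : ℝ} {f : L2Field} (hf : ‖f‖ ≤ C) (K : Set Plane) :
    ‖restrictCLM K f‖ₑ ≤ ENNReal.ofReal C := by
  rw [Lp.enorm_def, eLpNorm_congr_ae (LpToLpRestrictCLM_coeFn ℝ K f)]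
  refine (eLpNorm_restrict_le _ _ _ _).trans ?_
  rw [← Lp.enorm_def, ← ofReal_norm]
  exact ENNReal.ofReal_le_ofReal hf

/-- Compactness of curves that are bounded in `L²`, equicontinuous in `H^{-L}` and have a uniform
modulus of continuity for the structure function. -/
theorem exists_subseq_tendstoL2L2loc (T : ℝ) {w : ℕ → ℝ → L2Field} (hcont : ∀ n, Continuous (w n))
    {C : ℝ} (hC : ∀ n t, ‖w n t‖ ≤ C) {L : ℝ} (hL : 0 < L) {M : ℝ}
    (hM : ∀ n s t, negSobolevNorm L (w n t - w n s) ≤ M * |t - s|)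
    {φ : ℝ → ℝ} (hφ : Tendsto φ (𝓝[>] 0) (𝓝 0))
    (hS : ∀ n t, ∀ r > 0, structureFunction (w n t) r ≤ φ r) :
    ∃ k : ℕ → ℕ, StrictMono k ∧ ∃ v : ℝ → Plane → Plane, MemL2L2loc T v ∧
      TendstoL2L2loc T (fun n t x => w (k n) t x) v := by
  have : Fact ((2 : ℝ≥0∞) ≠ ∞) := ⟨by simp⟩
  have hequi : ∀ g : L2Field, ∀ κ > 0, ∃ ρ > 0, ∀ n s t, |t - s| < ρ →
      |inner ℝ g (w n t - w n s)| ≤ κ := by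
    intro g κ hκ
    obtain ⟨ρ, hρ, h⟩ := exists_abs_inner_le_of_negSobolevNorm hL g (C + C) hκ
    -- The denominator stays positive whatever the sign of `M`.
    refine ⟨ρ / (|M| + 1), by positivity, fun n s t hst => h _ ?_ ?_⟩
    · exact (norm_sub_le _ _).trans (add_le_add (hC n t) (hC n s))
    · calc negSobolevNorm L (w n t - w n s) ≤ M * |t - s| := hM n s t
        _ ≤ (|M| + 1) * (ρ / (|M| + 1)) := by
          gcongr
          linarith [le_abs_self M]
        _ = ρ := by field_simp
  obtain ⟨k, hk, V, hV⟩ := exists_subseq_weak_limit hC hequi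
  have hVC : ∀ t, ‖V t‖ ≤ C := fun t => norm_le_of_weak_limit (hV t) fun n => hC _ _
  have hstrong : ∀ K : Set Plane, IsCompact K → ∀ t,
      Tendsto (fun n => restrictCLM K (w (k n) t)) atTop (𝓝 (restrictCLM K (V t))) :=
    fun K hK t => tendsto_restrict_of_structureFunction (fun n => hC _ _) (hV t) hφ
      (fun n => hS _ _) hK
  refine ⟨k, hk, jointRepresentative V, ⟨?_, fun K _ => ?_⟩, fun K hK => ?_⟩
  · exact (stronglyMeasurable_jointRepresentative (fun n => hcont (k n)) hV).aestronglyMeasurable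
  · have hle : ∀ t, ∫⁻ x in K, ‖jointRepresentative V t x‖ₑ ^ 2 ≤ ENNReal.ofReal C ^ 2 := by
      intro t
      rw [← enorm_sq_eq_lintegral ((LpToLpRestrictCLM_coeFn ℝ K (V t)).trans
        (ae_restrict_of_ae (jointRepresentative_ae_eq V t).symm))]
      gcongr
      exact enorm_restrict_le (hVC t) K
    refine (lintegral_mono hle).trans_lt ?_
    rw [setLIntegral_const]
    exact ENNReal.mul_lt_top (by simp) measure_Icc_lt_top
  · simp only [lintegral_restrict_eq]
    rw [← lintegral_zero (μ := (volume : Measure ℝ).restrict (Icc 0 T))]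
    refine tendsto_lintegral_of_dominated_convergence'
      (fun _ => (ENNReal.ofReal C + ENNReal.ofReal C) ^ 2) (fun n => ?_)
      (fun n => ae_of_all _ fun t => ?_) ?_ (ae_of_all _ fun t => ?_)
    -- Replacing `V` by `w (k m)` gives functions continuous in `t`; strong convergence as `m → ∞`
    -- then gives measurability.
    · refine Measurable.aemeasurable (measurable_of_tendsto_metrizable
        (f := fun m t => ‖restrictCLM K (w (k n) t) - restrictCLM K (w (k m) t)‖ₑ ^ 2)
        (fun m => ?_) (tendsto_pi_nhds.2 fun t => ?_))
      · exact (((restrictCLM K).continuous.comp (hcont _)).sub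
          ((restrictCLM K).continuous.comp (hcont _))).enorm.measurable.pow_const 2
      · exact ENNReal.Tendsto.pow (((hstrong K hK t).const_sub _).enorm)
    · dsimp only
      gcongr
      refine enorm_sub_le.trans ?_
      gcongr
      · exact enorm_restrict_le (hC _ _) K
      · exact enorm_restrict_le (hVC _) K
    · rw [setLIntegral_const]
      exact (ENNReal.mul_lt_top (by simp) measure_Icc_lt_top).ne
    · have h := ((hstrong K hK t).sub_const (restrictCLM K (V t))).enorm
      simpa using ENNReal.Tendsto.pow (n := 2) h

end Compactness

end Euler2D

end

theorem proposition2p1 (T : ℝ) (hT : 0 < T)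
    (u : ℝ → ℝ → Euler2D.L2Field) (ω : ℝ → ℝ → MeasureTheory.SignedMeasure Euler2D.Plane)
    (u₀ : Euler2D.L2Field) (ω₀ : MeasureTheory.SignedMeasure Euler2D.Plane)
    (hu : Euler2D.IsApproximateSolutionSequence T u ω u₀ ω₀)
    (φ : ℝ → ℝ) (hφ : Tendsto φ (𝓝[>] 0) (𝓝 0))
    (hS : ∀ ε > 0, ∀ t ∈ Icc 0 T, ∀ r > 0, Euler2D.structureFunction (u ε t) r ≤ φ r) :
    Euler2D.IsPrecompactL2L2loc T u := by
  intro e he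
  obtain ⟨C, hC⟩ := hu.energy_bound
  obtain ⟨L, hL, M, hM⟩ := hu.lipschitz
  have hproj : ∀ t ∈ Icc 0 T, (projIcc 0 T hT.le t : ℝ) = t := fun t ht => by
    rw [projIcc_of_mem hT.le ht]
  -- Clamping time to `[0, T]` extends the curves to all of `ℝ`; the projection is 1-Lipschitz, so
  -- the estimates persist with `|M|`.
  obtain ⟨k, hk, v, hv, hlim⟩ := Euler2D.exists_subseq_tendstoL2L2loc T
    (w := fun n t => u (e n) (projIcc 0 T hT.le t))
    (fun n => (hu.continuousOn _ (he n)).comp_continuous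
      (continuous_subtype_val.comp continuous_projIcc) fun t => (projIcc 0 T hT.le t).2)
    (fun n t => hC _ (he n) _ (projIcc 0 T hT.le t).2) hL (M := |M|)
    (fun n s t => (hM _ (he n) _ (projIcc 0 T hT.le s).2 _ (projIcc 0 T hT.le t).2).trans
      (mul_le_mul (le_abs_self M) (abs_projIcc_sub_projIcc hT.le) (abs_nonneg _) (abs_nonneg _)))
    hφ (fun n t => hS _ (he n) _ (projIcc 0 T hT.le t).2)
  refine ⟨k, hk, v, hv, fun K hK => (hlim K hK).congr fun n => ?_⟩
  refine setLIntegral_congr_fun measurableSet_Icc fun t ht => ?_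
  simp only [hproj t ht]
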